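/- Let $\eta(x)=-x\ln x$ for $x>0$ and $\eta(0)=0$. Let $U\in\mathsf U(d)$, and let $\Pi$ be a rank-one projection valued measure (PVM) on $\mathbb C^d$, that is, $\Pi_j=|\varphi_j\rangle\langle\varphi_j|$ ($j=1,\dots,d$) for an orthonormal basis $(\varphi_j)_{j=1}^d$ of $\mathbb C^d$. For a state $\rho$ and a string $(i_1,\dots,i_n)\in\{1,\dots,d\}^n$, $n\ge 1$, put \[ P_{i_1,\dots,i_n}(\rho)=\operatorname{tr}(\rho\,\Pi_{i_1})\prod_{m=1}^{n-1}|\langle\varphi_{i_m}|U|\varphi_{i_{m+1}}\rangle|^2 , \qquad H_n=\sum_{i_1,\dots,i_n=1}^{d}\eta\bigl(P_{i_1,\dots,i_n}(\mathbb I/d)\bigr), \] and let \[ H(U,\Pi)=\lim_{n\to\infty}\frac{H_n}{n}=\lim_{n\to\infty}(H_{n+1}-H_n), \qquad H_{\mathrm{dyn}}(U,\Pi)=H(U,\Pi)-H(\mathbb I,\Pi), \] \[ H^{\mathrm{dyn}}(U)=\max_{\Pi}H_{\mathrm{dyn}}(U,\Pi), \] the maximum being taken over all such PVMs $\Pi$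 on $\mathbb C^d$ ($H^{\mathrm{dyn}}(U)$ is the PVM-dynamical entropy of $U$). **Theorem (average PVM-dynamical entropy for $\mathsf U(2)$).** For $d=2$, the two limits above exist and are equal for all $U$ and $\Pi$, the maximum is attained for every $U\in\mathsf U(2)$, the function $H^{\mathrm{dyn}}$ is integrable with respect to the normalized Haar measure $m$ on $\mathsf U(2)$, and \[ \int_{\mathsf U(2)}H^{\mathrm{dyn}}(U)\,dm(U)=\frac32\ln 2-\frac12-\frac1{2\pi}+\frac{C}{\pi}\approx 0.672 , \] where $C=\sum_{n=0}^{\infty}\frac{(-1)^n}{(2n+1)^2}\approx 0.916$ is Catalan's constant. Both numerical values are correct to within $5\cdot10^{-4}$. -/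

import Mathlib

noncomputable section

namespace QuantumEntropy

/-- A rank-one projection valued measure (PVM) on `ℂ^d`, given by the (ordered) orthonormal basis
`φ` which generates it; the basis vectors matter only up to phases. -/
abbrev PVM (d : ℕ) : Type := OrthonormalBasis (Fin d) ℂ (EuclideanSpace ℂ (Fin d))

/-- The `j`-th effect `Π_j = |φ_j⟩⟨φ_j|` of a PVM. -/
def PVM.effect {d : ℕ} (φ : PVM d) (j : Fin d) : Matrix (Fin d) (Fin d) ℂ :=
  Matrix.vecMulVec (φ j).ofLp (star (φ j).ofLp)

/-- The probability `p_j(ρ) = tr (ρ Π_j)` of the outcome `j` in the state `ρ`. -/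
def outcomeProb {d : ℕ} (φ : PVM d) (ρ : Matrix (Fin d) (Fin d) ℂ) (j : Fin d) : ℝ :=
  (Matrix.trace (ρ * φ.effect j)).re

/-- The transition probability `p_{jl} = |⟨φ_j|U|φ_l⟩|²`. -/
def transitionProb {d : ℕ} (U : Matrix.unitaryGroup (Fin d) ℂ) (φ : PVM d) (j l : Fin d) : ℝ :=
  ‖inner ℂ (φ j) (Matrix.toEuclideanLin (U : Matrix (Fin d) (Fin d) ℂ) (φ l))‖ ^ 2

/-- The maximally mixed state `ρ_* = I / d`. -/
def maximallyMixed (d : ℕ) : Matrix (Fin d) (Fin d) ℂ := (1 / (d : ℂ)) • 1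

/-- The probability `P_{i_1,…,i_{n+1}}(ρ) = p_{i_1}(ρ) ∏_{m=1}^{n} p_{i_m i_{m+1}}` of obtaining a
given nonempty string of outcomes in consecutive measurements, starting from the state `ρ`. -/
def stringProb {d : ℕ} (U : Matrix.unitaryGroup (Fin d) ℂ) (φ : PVM d)
    (ρ : Matrix (Fin d) (Fin d) ℂ) {n : ℕ} (i : Fin (n + 1) → Fin d) : ℝ :=
  outcomeProb φ ρ (i 0) * ∏ m : Fin n, transitionProb U φ (i m.castSucc) (i m.succ)

/-- The block entropy `H_n`: the Shannon entropy (natural logarithm) of the strings of `n`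
consecutive outcomes in the stationary regime, `Real.negMulLog` being the Shannon function
`η x = - x ln x`, `η 0 = 0`. -/
def blockEntropy {d : ℕ} (U : Matrix.unitaryGroup (Fin d) ℂ) (φ : PVM d) : ℕ → ℝ
  | 0 => 0
  | n + 1 => ∑ i : Fin (n + 1) → Fin d,
      Real.negMulLog (stringProb U φ (maximallyMixed d) i)

/-- The quantum entropy `H(U, Π) = lim H_n / n` of `U` with respect to the PVM. -/
def entropy {d : ℕ} (U : Matrix.unitaryGroup (Fin d) ℂ) (φ : PVM d) : ℝ :=
  Filter.limUnder Filter.atTop (fun n : ℕ => blockEntropy U φ n / (n : ℝ))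

/-- The measurement entropy `H_meas(Π) = H(I, Π)`. -/
def measurementEntropy {d : ℕ} (φ : PVM d) : ℝ := entropy 1 φ

/-- The dynamical entropy `H_dyn(U, Π) = H(U, Π) - H_meas(Π)` of `U` with respect to the PVM. -/
def dynamicalEntropy {d : ℕ} (U : Matrix.unitaryGroup (Fin d) ℂ) (φ : PVM d) : ℝ :=
  entropy U φ - measurementEntropy φ

/-- The PVM-dynamical entropy `H^dyn(U)`: the supremum of `H_dyn(U, Π)` over all PVMs. -/
def pvmDynamicalEntropy {d : ℕ} (U : Matrix.unitaryGroup (Fin d) ℂ) : ℝ :=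
  ⨆ φ : PVM d, dynamicalEntropy U φ

/-- Catalan's constant `C = ∑ (-1)^n / (2n+1)^2`. -/
def catalanConstant : ℝ := ∑' n : ℕ, (-1 : ℝ) ^ n / (2 * (n : ℝ) + 1) ^ 2

end QuantumEntropy

end

/-! For `d = 2` the transition matrix is bistochastic, hence has rows `(p, 1 - p)` and `(1 - p, p)`
with `p = transitionProb U φ 0 0`. Every further measurement adds exactly `binEntropy p` to the
block entropy, so both limits equal `binEntropy p`, and the measurement entropy vanishes. Put `T =
|tr U|² / 4`. As the basis varies, `p` runs over `[T, 1]`; since binary entropy peaks at `1/2` and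
decreases afterwards, the maximum is `binEntropy (max T 2⁻¹)` (`pvmDynamicalEntropy_eq`).

It remains to find the law of `T` under Haar measure: it is that of `cos² x` with density `(4/π)
sin² x` on `[0, π/2]` (`integral_comp_normTraceSq`). Instead of a Weyl integration formula, moments
are used. Invariance under the subgroups `exp (t W)`, with `W` one of three skew-hermitian square
roots of `-1`, gives a recursion for `∫ T ^ k` (`integral_normTraceSq_pow_succ`). The trigonometric
moments satisfy the same recursion, and Weierstrass approximation passes from powers to continuous
functions (`integral_comp_eq_of_moments`).

The resulting integral is constant in the entropy factor beyond `π/4`; on `[0, π/4]` an explicit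
primitive reduces it to the integrals of `log sin` and `log cos`, whose difference is `-C`. -/

namespace QuantumEntropy

open Filter Topology Real MeasureTheory

/-! ### Block entropies and their limits in dimension two -/

section

/-- The matrix of `U` in the basis generating a PVM. -/
noncomputable def pvmMatrix {d : ℕ} (U : Matrix.unitaryGroup (Fin d) ℂ) (φ : PVM d) :
    Matrix (Fin d) (Fin d) ℂ :=
  LinearMap.toMatrixOrthonormal φ (Matrix.toEuclideanLin (U : Matrix (Fin d) (Fin d) ℂ))

lemma pvmMatrix_apply {d : ℕ} (U : Matrix.unitaryGroup (Fin d) ℂ) (φ : PVM d) (j l : Fin d) :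
    pvmMatrix U φ j l =
      inner ℂ (φ j) (Matrix.toEuclideanLin (U : Matrix (Fin d) (Fin d) ℂ) (φ l)) := by
  simp [pvmMatrix, LinearMap.toMatrixOrthonormal_apply_apply]

lemma pvmMatrix_mem {d : ℕ} (U : Matrix.unitaryGroup (Fin d) ℂ) (φ : PVM d) :
    pvmMatrix U φ ∈ Matrix.unitaryGroup (Fin d) ℂ := by
  have h : Matrix.toEuclideanLin (U : Matrix (Fin d) (Fin d) ℂ) =
      (LinearMap.toMatrixOrthonormal (EuclideanSpace.basisFun (Fin d) ℂ)).symm U := by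
    rw [Matrix.toEuclideanLin_eq_toLin_orthonormal]
    rfl
  -- Taking the matrix in an orthonormal basis is a star-algebra equivalence, so it and its inverse
  -- preserve unitaries.
  unfold pvmMatrix
  rw [h]
  exact Unitary.map_mem _ (Unitary.map_mem _ U.2)

lemma trace_pvmMatrix {d : ℕ} (U : Matrix.unitaryGroup (Fin d) ℂ) (φ : PVM d) :
    (pvmMatrix U φ).trace = (U : Matrix (Fin d) (Fin d) ℂ).trace := by
  have h1 : (pvmMatrix U φ).trace = LinearMap.trace ℂ _
      (Matrix.toEuclideanLin (U : Matrix (Fin d) (Fin d) ℂ)) :=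
    (LinearMap.trace_eq_matrix_trace ℂ φ.toBasis _).symm
  rw [h1, LinearMap.trace_eq_matrix_trace ℂ (EuclideanSpace.basisFun (Fin d) ℂ).toBasis]
  congr 1
  ext i j
  simp [LinearMap.toMatrix_apply]

lemma transitionProb_eq {d : ℕ} (U : Matrix.unitaryGroup (Fin d) ℂ) (φ : PVM d) (j l : Fin d) :
    transitionProb U φ j l = ‖pvmMatrix U φ j l‖ ^ 2 := by
  rw [pvmMatrix_apply, transitionProb]

lemma unitary_row_sum {M : Matrix (Fin 2) (Fin 2) ℂ} (hM : M ∈ Matrix.unitaryGroup (Fin 2) ℂ)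
    (i : Fin 2) : ‖M i 0‖ ^ 2 + ‖M i 1‖ ^ 2 = 1 := by
  have h := congrFun (congrFun (Matrix.mem_unitaryGroup_iff.1 hM) i) i
  simp only [Matrix.mul_apply, Fin.sum_univ_two, Matrix.star_apply, Matrix.one_apply_eq,
    RCLike.star_def, Complex.mul_conj] at h
  rw [← Complex.normSq_eq_norm_sq, ← Complex.normSq_eq_norm_sq]
  exact_mod_cast h

lemma unitary_col_sum {M : Matrix (Fin 2) (Fin 2) ℂ} (hM : M ∈ Matrix.unitaryGroup (Fin 2) ℂ)
    (i : Fin 2) : ‖M 0 i‖ ^ 2 + ‖M 1 i‖ ^ 2 = 1 := by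
  have h := congrFun (congrFun (Matrix.mem_unitaryGroup_iff'.1 hM) i) i
  simp only [Matrix.mul_apply, Fin.sum_univ_two, Matrix.star_apply, Matrix.one_apply_eq,
    RCLike.star_def, mul_comm, Complex.mul_conj] at h
  rw [← Complex.normSq_eq_norm_sq, ← Complex.normSq_eq_norm_sq]
  exact_mod_cast h

/-- For a two-dimensional unitary, all transition probabilities are determined by one of them. -/
lemma transitionProb_two (U : Matrix.unitaryGroup (Fin 2) ℂ) (φ : PVM 2) (j l : Fin 2) :
    transitionProb U φ j l =
      if j = l then transitionProb U φ 0 0 else 1 - transitionProb U φ 0 0 := by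
  simp only [transitionProb_eq]
  have r := unitary_row_sum (pvmMatrix_mem U φ)
  have c := unitary_col_sum (pvmMatrix_mem U φ)
  have r0 := r 0
  have r1 := r 1
  have c0 := c 0
  fin_cases j <;> fin_cases l <;>
    simp only [Fin.zero_eta, Fin.mk_one, if_true, zero_ne_one, one_ne_zero, if_false] <;> linarith

lemma outcomeProb_maximallyMixed {d : ℕ} (φ : PVM d) (j : Fin d) :
    outcomeProb φ (maximallyMixed d) j = 1 / d := by
  have h : ∑ i, (φ j).ofLp i * star ((φ j).ofLp i) = 1 := by
    have h := φ.orthonormal.1 j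
    rw [EuclideanSpace.norm_eq, Real.sqrt_eq_one] at h
    simp only [RCLike.star_def, Complex.mul_conj, Complex.normSq_eq_norm_sq]
    exact_mod_cast h
  simp only [outcomeProb, maximallyMixed, PVM.effect, Matrix.smul_mul, one_mul,
    Matrix.trace_smul, Matrix.trace_vecMulVec, dotProduct, Pi.star_apply, h]
  simp

variable (U : Matrix.unitaryGroup (Fin 2) ℂ) (φ : PVM 2)

lemma stringProb_snoc {d n : ℕ} (U : Matrix.unitaryGroup (Fin d) ℂ) (φ : PVM d)
    (ρ : Matrix (Fin d) (Fin d) ℂ) (i : Fin (n + 1) → Fin d) (l : Fin d) :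
    stringProb U φ ρ (Fin.snoc i l : Fin (n + 2) → Fin d) =
      stringProb U φ ρ i * transitionProb U φ (i (Fin.last n)) l := by
  unfold stringProb
  rw [Fin.prod_univ_castSucc]
  have h0 : (Fin.snoc i l : Fin (n + 2) → Fin d) 0 = i 0 :=
    Fin.snoc_castSucc (α := fun _ => Fin d) l i 0
  have h1 (m : Fin (n + 1)) : (Fin.snoc i l : Fin (n + 2) → Fin d) m.castSucc = i m :=
    Fin.snoc_castSucc (α := fun _ => Fin d) l i m
  have h2 : (Fin.snoc i l : Fin (n + 2) → Fin d) (Fin.last n).succ = l :=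
    Fin.snoc_last (α := fun _ => Fin d) l i
  simp only [h0, h1, h2, Fin.succ_castSucc, mul_assoc]

lemma sum_snoc {d n : ℕ} (f : (Fin (n + 2) → Fin d) → ℝ) :
    ∑ i, f i = ∑ i : Fin (n + 1) → Fin d, ∑ l, f (Fin.snoc i l) := by
  rw [← (Fin.snocEquiv (fun _ : Fin (n + 2) => Fin d)).sum_comp, Fintype.sum_prod_type_right]
  rfl

lemma sum_transitionProb (j : Fin 2) : ∑ l, transitionProb U φ j l = 1 := by
  simp only [transitionProb_eq, Fin.sum_univ_two]
  exact unitary_row_sum (pvmMatrix_mem U φ) j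

lemma sum_negMulLog_transitionProb (j : Fin 2) :
    ∑ l, negMulLog (transitionProb U φ j l) = binEntropy (transitionProb U φ 0 0) := by
  rw [binEntropy_eq_negMulLog_add_negMulLog_one_sub, Fin.sum_univ_two,
    transitionProb_two U φ j 0, transitionProb_two U φ j 1]
  fin_cases j <;> simp [add_comm]

lemma sum_stringProb (n : ℕ) :
    ∑ i : Fin (n + 1) → Fin 2, stringProb U φ (maximallyMixed 2) i = 1 := by
  induction n with
  | zero => simp [stringProb, outcomeProb_maximallyMixed]
  | succ n ih =>
    rw [sum_snoc]
    simp only [stringProb_snoc, ← Finset.mul_sum, sum_transitionProb, mul_one, ih]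

/-- Chain rule for entropy: `negMulLog_mul` splits off the last transition, and all rows of the
transition matrix have the same entropy, so the increment does not depend on the preceding outcomes.
-/
lemma blockEntropy_succ (n : ℕ) :
    blockEntropy U φ (n + 1) = log 2 + n * binEntropy (transitionProb U φ 0 0) := by
  induction n with
  | zero =>
    simp [blockEntropy, stringProb, outcomeProb_maximallyMixed, negMulLog]
  | succ n ih =>
    have h : blockEntropy U φ (n + 1 + 1) =
        blockEntropy U φ (n + 1) + binEntropy (transitionProb U φ 0 0) := by
      simp only [blockEntropy]
      rw [sum_snoc]
      simp only [stringProb_snoc, negMulLog_mul, Finset.sum_add_distrib, ← Finset.sum_mul,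
        ← Finset.mul_sum, sum_transitionProb, one_mul, sum_negMulLog_transitionProb,
        sum_stringProb]
    rw [h, ih]
    push_cast
    ring

lemma tendsto_blockEntropy_div : Tendsto (fun n : ℕ => blockEntropy U φ n / (n : ℝ)) atTop
    (𝓝 (binEntropy (transitionProb U φ 0 0))) := by
  set b := binEntropy (transitionProb U φ 0 0) with hb
  -- A string of `n` outcomes has only `n - 1` transitions, whence `log 2 - b` in place of `log 2`.
  have h1 : Tendsto (fun n : ℕ => (log 2 - b) / ((n : ℝ)) + b) atTop (𝓝 (0 + b)) :=
    (tendsto_const_div_atTop_nhds_zero_nat _).add_const _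
  rw [zero_add] at h1
  refine h1.congr' ?_
  filter_upwards [eventually_ge_atTop 1] with n hn
  obtain ⟨k, rfl⟩ := Nat.exists_eq_add_of_le' hn
  rw [blockEntropy_succ, ← hb]
  have : ((k + 1 : ℕ) : ℝ) ≠ 0 := by positivity
  field_simp
  push_cast
  ring

lemma entropy_eq : entropy U φ = binEntropy (transitionProb U φ 0 0) :=
  (tendsto_blockEntropy_div U φ).limUnder_eq

lemma tendsto_blockEntropy_sub : Tendsto
    (fun n : ℕ => blockEntropy U φ (n + 1) - blockEntropy U φ n) atTop
    (𝓝 (binEntropy (transitionProb U φ 0 0))) := by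
  refine tendsto_const_nhds.congr' ?_
  filter_upwards [eventually_ge_atTop 1] with n hn
  obtain ⟨k, rfl⟩ := Nat.exists_eq_add_of_le' hn
  rw [blockEntropy_succ, blockEntropy_succ]
  push_cast
  ring

lemma measurementEntropy_eq_zero : measurementEntropy φ = 0 := by
  have h : transitionProb 1 φ 0 0 = 1 := by
    simp [transitionProb]
  rw [measurementEntropy, entropy_eq, h, binEntropy_one]

lemma dynamicalEntropy_eq : dynamicalEntropy U φ = binEntropy (transitionProb U φ 0 0) := by
  rw [dynamicalEntropy, entropy_eq, measurementEntropy_eq_zero, sub_zero]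

end

/-! ### The range of the transition probability and the maximal entropy -/

section

variable (U : Matrix.unitaryGroup (Fin 2) ℂ) (φ : PVM 2)

/-- The normalized squared modulus `|tr U|² / 4` of the trace. -/
noncomputable def normTraceSq (U : Matrix.unitaryGroup (Fin 2) ℂ) : ℝ :=
  ‖(U : Matrix (Fin 2) (Fin 2) ℂ).trace‖ ^ 2 / 4

lemma normTraceSq_nonneg : 0 ≤ normTraceSq U := by unfold normTraceSq; positivity

/-- The two diagonal entries of a `2 × 2` unitary have equal modulus, so the triangle inequality
bounds the trace by twice that modulus. -/
lemma normTraceSq_le_transitionProb : normTraceSq U ≤ transitionProb U φ 0 0 := by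
  rw [normTraceSq, ← trace_pvmMatrix U φ, transitionProb_eq, Matrix.trace_fin_two]
  have r1 := unitary_row_sum (pvmMatrix_mem U φ) 1
  have c0 := unitary_col_sum (pvmMatrix_mem U φ) 0
  have e : ‖pvmMatrix U φ 1 1‖ = ‖pvmMatrix U φ 0 0‖ := by
    rw [← sq_eq_sq₀ (norm_nonneg _) (norm_nonneg _)]; linarith
  have h := norm_add_le (pvmMatrix U φ 0 0) (pvmMatrix U φ 1 1)
  rw [e] at h
  nlinarith [norm_nonneg (pvmMatrix U φ 0 0 + pvmMatrix U φ 1 1)]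

lemma transitionProb_le_one (j l : Fin 2) : transitionProb U φ j l ≤ 1 := by
  have h := sum_transitionProb U φ j
  rw [Fin.sum_univ_two] at h
  have h0 : 0 ≤ transitionProb U φ j 0 := sq_nonneg _
  have h1 : 0 ≤ transitionProb U φ j 1 := sq_nonneg _
  fin_cases l <;> simp only [Fin.zero_eta, Fin.mk_one] <;> linarith

lemma normTraceSq_le_one : normTraceSq U ≤ 1 :=
  (normTraceSq_le_transitionProb U (EuclideanSpace.basisFun (Fin 2) ℂ)).trans
    (transitionProb_le_one U _ 0 0)

/-- If `T ≤ 1/2`, the bound is the global maximum `log 2`; otherwise `p ≥ T` lies where binary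
entropy decreases. -/
lemma binEntropy_transitionProb_le :
    binEntropy (transitionProb U φ 0 0) ≤ binEntropy (max (normTraceSq U) 2⁻¹) := by
  have h0 := normTraceSq_le_transitionProb U φ
  have h1 := transitionProb_le_one U φ 0 0
  rcases le_total (normTraceSq U) 2⁻¹ with h | h
  · rw [max_eq_right h, binEntropy_two_inv]
    exact binEntropy_le_log_two
  · rw [max_eq_left h]
    exact binEntropy_strictAntiOn.antitoneOn ⟨h, h0.trans h1⟩ ⟨h.trans h0, h1⟩ h0

lemma PVM.inner_eq_ite {d : ℕ} (φ : PVM d) (j l : Fin d) :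
    inner ℂ (φ j) (φ l) = if j = l then (1 : ℂ) else 0 :=
  orthonormal_iff_ite.1 φ.orthonormal j l

/-- Every orthonormal pair of vectors in `ℂ²` is a PVM. -/
lemma exists_pvm_of_orthonormal {v : Fin 2 → EuclideanSpace ℂ (Fin 2)} (hv : Orthonormal ℂ v) :
    ∃ φ : PVM 2, ⇑φ = v :=
  ⟨OrthonormalBasis.mk hv (hv.linearIndependent.span_eq_top_of_card_eq_finrank (by simp)).ge,
    OrthonormalBasis.coe_mk _ _⟩

/-- Every unit vector of `ℂ²` is the first vector of some PVM. -/
lemma exists_pvm_apply_zero_eq {x : EuclideanSpace ℂ (Fin 2)} (hx : ‖x‖ = 1) :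
    ∃ φ : PVM 2, φ 0 = x := by
  have hs : ‖x.ofLp 0‖ ^ 2 + ‖x.ofLp 1‖ ^ 2 = 1 := by
    rw [EuclideanSpace.norm_eq, Real.sqrt_eq_one] at hx
    simpa using hx
  have hv : Orthonormal ℂ ![x, !₂[-star (x.ofLp 1), star (x.ofLp 0)]] := by
    rw [orthonormal_iff_ite]
    intro i j
    fin_cases i <;> fin_cases j
    · simp [inner_self_eq_norm_sq_to_K, hx]
    · simp [PiLp.inner_apply]; ring
    · simp [PiLp.inner_apply]; ring
    · rw [if_pos rfl]
      have : ‖(!₂[-star (x.ofLp 1), star (x.ofLp 0)] : EuclideanSpace ℂ (Fin 2))‖ = 1 := by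
        rw [EuclideanSpace.norm_eq, Real.sqrt_eq_one]
        simpa [add_comm] using hs
      simp only [Fin.mk_one, Matrix.cons_val_one, Matrix.cons_val_fin_one,
        inner_self_eq_norm_sq_to_K, this]
      simp
  obtain ⟨φ, hφ⟩ := exists_pvm_of_orthonormal hv
  exact ⟨φ, by simp [hφ]⟩

/-- A unitary on `ℂ²` is diagonal in some orthonormal basis. -/
lemma exists_pvm_diagonal : ∃ (φ : PVM 2) (a b : ℂ), ‖a‖ = 1 ∧ ‖b‖ = 1 ∧
    Matrix.toEuclideanLin (U : Matrix (Fin 2) (Fin 2) ℂ) (φ 0) = a • φ 0 ∧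
    Matrix.toEuclideanLin (U : Matrix (Fin 2) (Fin 2) ℂ) (φ 1) = b • φ 1 := by
  obtain ⟨a, ha⟩ := Module.End.exists_eigenvalue
    (Matrix.toEuclideanLin (U : Matrix (Fin 2) (Fin 2) ℂ))
  obtain ⟨v, hv⟩ := ha.exists_hasEigenvector
  have hv0 : ‖v‖ ≠ 0 := norm_ne_zero_iff.2 hv.2
  obtain ⟨φ, hφ⟩ := exists_pvm_apply_zero_eq (x := ((‖v‖⁻¹ : ℝ) : ℂ) • v)
    (by rw [norm_smul]; simp [hv0])
  have h0 : Matrix.toEuclideanLin (U : Matrix (Fin 2) (Fin 2) ℂ) (φ 0) = a • φ 0 := by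
    rw [hφ, map_smul, hv.apply_eq_smul, smul_comm]
  have m00 : pvmMatrix U φ 0 0 = a := by
    rw [pvmMatrix_apply, h0, inner_smul_right, PVM.inner_eq_ite]; simp
  have m10 : pvmMatrix U φ 1 0 = 0 := by
    rw [pvmMatrix_apply, h0, inner_smul_right, PVM.inner_eq_ite]; simp
  have c0 := unitary_col_sum (pvmMatrix_mem U φ) 0
  have r0 := unitary_row_sum (pvmMatrix_mem U φ) 0
  have r1 := unitary_row_sum (pvmMatrix_mem U φ) 1
  rw [m10, m00] at c0
  rw [m00] at r0
  rw [m10] at r1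
  simp only [norm_zero, ne_eq, OfNat.ofNat_ne_zero, not_false_eq_true, zero_pow, add_zero,
    zero_add] at c0 r1
  -- The eigenvalue `a` has modulus one and already exhausts row `0`.
  have m01 : pvmMatrix U φ 0 1 = 0 := by
    rw [← norm_eq_zero, ← sq_eq_zero_iff]; linarith
  refine ⟨φ, a, pvmMatrix U φ 1 1, ?_, ?_, h0, ?_⟩
  · rwa [← pow_eq_one_iff_of_nonneg (norm_nonneg _) two_ne_zero]
  · rwa [← pow_eq_one_iff_of_nonneg (norm_nonneg _) two_ne_zero]
  · conv_lhs => rw [← φ.sum_repr' (Matrix.toEuclideanLin (U : Matrix (Fin 2) (Fin 2) ℂ) (φ 1))]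
    rw [Fin.sum_univ_two, ← pvmMatrix_apply, ← pvmMatrix_apply, m01]
    simp

/-- All transition probabilities between `|tr U|² / 4` and `1` occur. -/
lemma exists_transitionProb_eq {q : ℝ} (hq : normTraceSq U ≤ q) (hq1 : q ≤ 1) :
    ∃ φ : PVM 2, transitionProb U φ 0 0 = q := by
  obtain ⟨φ, a, b, ha, hb, h0, h1⟩ := exists_pvm_diagonal U
  -- Rotating the eigenbasis by `θ` turns the diagonal entry into the convex combination `cos² θ · a
  -- + sin² θ · b`. It has modulus `1` at `θ = 0` and is the midpoint `tr U / 2` at `θ = π / 4`;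
  -- continuity gives everything between.
  have key (θ : ℝ) : ∃ ψ : PVM 2, transitionProb U ψ 0 0 =
      ‖((cos θ ^ 2 : ℝ) : ℂ) * a + ((sin θ ^ 2 : ℝ) : ℂ) * b‖ ^ 2 := by
    obtain ⟨ψ, hψ⟩ := exists_pvm_apply_zero_eq (x := (cos θ : ℂ) • φ 0 + (sin θ : ℂ) • φ 1) (by
      rw [← pow_eq_one_iff_of_nonneg (norm_nonneg _) two_ne_zero]
      have h := φ.orthonormal.1
      rw [@norm_add_sq ℂ, norm_smul, norm_smul, h, h, inner_smul_left, inner_smul_right,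
        PVM.inner_eq_ite, Complex.norm_real, Complex.norm_real]
      simp)
    refine ⟨ψ, ?_⟩
    rw [transitionProb, hψ, map_add, map_smul, map_smul, h0, h1]
    congr 2
    simp only [inner_add_left, inner_add_right, inner_smul_left, inner_smul_right,
      PVM.inner_eq_ite, Complex.conj_ofReal]
    simp
    ring
  have htr : normTraceSq U = ‖a + b‖ ^ 2 / 4 := by
    rw [normTraceSq, ← trace_pvmMatrix U φ, Matrix.trace_fin_two, pvmMatrix_apply,
      pvmMatrix_apply, h0, h1, inner_smul_right, inner_smul_right, PVM.inner_eq_ite,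
      PVM.inner_eq_ite]
    simp
  let f : ℝ → ℝ := fun θ => ‖((cos θ ^ 2 : ℝ) : ℂ) * a + ((sin θ ^ 2 : ℝ) : ℂ) * b‖ ^ 2
  have hf : Continuous f := by fun_prop
  have f0 : f 0 = 1 := by simp [f, ha]
  have f1 : f (π / 4) = normTraceSq U := by
    have hc : cos (π / 4) ^ 2 = 1 / 2 := by rw [cos_pi_div_four, div_pow]; norm_num
    have hs : sin (π / 4) ^ 2 = 1 / 2 := by rw [sin_pi_div_four, div_pow]; norm_num
    simp only [f, hc, hs]
    rw [htr, ← mul_add, norm_mul]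
    norm_num [mul_pow]
    ring
  obtain ⟨θ, -, hθ⟩ := intermediate_value_Icc' (by positivity) hf.continuousOn
    (show q ∈ Set.Icc (f (π / 4)) (f 0) by rw [f0, f1]; exact ⟨hq, hq1⟩)
  obtain ⟨ψ, hψ⟩ := key θ
  exact ⟨ψ, hψ.trans hθ⟩

lemma isGreatest_dynamicalEntropy : IsGreatest (Set.range fun φ : PVM 2 => dynamicalEntropy U φ)
    (binEntropy (max (normTraceSq U) 2⁻¹)) := by
  constructor
  · obtain ⟨φ, hφ⟩ := exists_transitionProb_eq U (le_max_left _ 2⁻¹)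
      (max_le (normTraceSq_le_one U) (by norm_num))
    exact ⟨φ, by simp only [dynamicalEntropy_eq, hφ]⟩
  · rintro _ ⟨φ, rfl⟩
    simp only [dynamicalEntropy_eq]
    exact binEntropy_transitionProb_le U φ

lemma pvmDynamicalEntropy_eq :
    pvmDynamicalEntropy U = binEntropy (max (normTraceSq U) 2⁻¹) :=
  (isGreatest_dynamicalEntropy U).csSup_eq

end

/-! ### Catalan's constant and the integrals of `log sin` and `log cos` -/

lemma hasSum_catalanConstant : HasSum (fun n : ℕ => (-1 : ℝ) ^ n / (2 * (n : ℝ) + 1) ^ 2)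
    catalanConstant := by
  refine Summable.hasSum ?_
  have h : Summable fun n : ℕ => 1 / ((n + 1 : ℕ) : ℝ) ^ 2 :=
    (summable_nat_add_iff 1).2 (Real.summable_one_div_nat_pow.2 one_lt_two)
  refine Summable.of_norm_bounded h fun n => ?_
  rw [norm_div, norm_pow, norm_neg, norm_one, one_pow, norm_pow, Real.norm_eq_abs,
    abs_of_nonneg (by positivity)]
  push_cast
  gcongr
  linarith

lemma abs_catalanConstant_sub_lt : |catalanConstant - 0.916| < 0.0005 := by
  have h := hasSum_catalanConstant.tendsto_sum_nat
  simp only [div_eq_mul_inv] at h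
  have ha : Antitone fun n : ℕ => ((2 * (n : ℝ) + 1) ^ 2)⁻¹ := by
    intro a b hab
    have : (a : ℝ) ≤ b := by exact_mod_cast hab
    dsimp only
    gcongr
  have h1 := ha.alternating_series_le_tendsto h 11
  have h2 := ha.tendsto_le_alternating_series h 11
  norm_num [Finset.sum_range_succ] at h1 h2
  rw [abs_lt]
  constructor <;> linarith

lemma integral_pow_mul_log (n : ℕ) :
    ∫ u in (0 : ℝ)..1, u ^ n * log u = -1 / ((n : ℝ) + 1) ^ 2 := by
  have hn : (n : ℝ) + 1 ≠ 0 := by positivity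
  have key := intervalIntegral.integral_eq_sub_of_hasDerivAt_of_le zero_le_one
    -- Integration by parts; the factor `u * log u` is kept together because it is continuous at
    -- `0`.
    (f := fun u => u ^ n * (u * log u) / (n + 1) - u ^ (n + 1) / (n + 1) ^ 2)
    (f' := fun u => u ^ n * log u)
    (Continuous.continuousOn (by
      have := continuous_mul_log
      fun_prop))
    (fun u hu => by
      have hu0 : u ≠ 0 := hu.1.ne'
      have h1 := (((hasDerivAt_pow (n + 1) u).mul (hasDerivAt_log hu0)).div_const ((n : ℝ) + 1)).sub
        ((hasDerivAt_pow (n + 1) u).div_const (((n : ℝ) + 1) ^ 2))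
      refine (h1.congr_deriv ?_).congr_of_eventuallyEq (Eventually.of_forall fun x => ?_)
      · simp only [Nat.add_sub_cancel]
        push_cast
        field_simp
        ring
      · simp only [Pi.sub_apply, Pi.mul_apply]
        ring)
    (intervalIntegral.intervalIntegrable_log'.continuousOn_mul (by fun_prop))
  rw [key]
  simp
  field_simp

/-- `∫₀¹ log u / (1 + u²) du = -C`. -/
lemma integral_log_div_one_add_sq :
    ∫ u in (0 : ℝ)..1, log u / (1 + u ^ 2) = -catalanConstant := by
  have hint (n : ℕ) : IntervalIntegrable (fun u : ℝ => (-1) ^ n * (u ^ (2 * n) * log u))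
      volume 0 1 :=
    (intervalIntegral.intervalIntegrable_log'.continuousOn_mul (by fun_prop)).const_mul _
  have hnorm (n : ℕ) : ∫ u in Set.Ioo (0 : ℝ) 1, ‖(-1) ^ n * (u ^ (2 * n) * log u)‖ =
      1 / (2 * (n : ℝ) + 1) ^ 2 := by
    have h := integral_pow_mul_log (2 * n)
    rw [intervalIntegral.integral_of_le zero_le_one, integral_Ioc_eq_integral_Ioo] at h
    have h2 : ∫ u in Set.Ioo (0 : ℝ) 1, ‖(-1) ^ n * (u ^ (2 * n) * log u)‖ =
        ∫ u in Set.Ioo (0 : ℝ) 1, -(u ^ (2 * n) * log u) := by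
      refine setIntegral_congr_fun measurableSet_Ioo fun u hu => ?_
      simp only [norm_mul, norm_pow, norm_neg, norm_one, one_pow, one_mul, Real.norm_eq_abs]
      rw [abs_of_pos hu.1, abs_of_neg (log_neg hu.1 hu.2)]
      ring
    rw [h2, integral_neg, h]
    push_cast
    ring
  -- Expand `1 / (1 + u²)` as a geometric series and integrate termwise. The norms have integrals `1
  -- / (2n + 1)²`, which are summable. The open interval keeps `u² < 1`.
  have hs := hasSum_integral_of_summable_integral_norm
    (μ := volume.restrict (Set.Ioo (0 : ℝ) 1))
    (F := fun (n : ℕ) (u : ℝ) => (-1) ^ n * (u ^ (2 * n) * log u))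
    (fun n => ((intervalIntegrable_iff_integrableOn_Ioc_of_le zero_le_one).1 (hint n)).mono_set
      Set.Ioo_subset_Ioc_self)
    (by
      simp only [hnorm]
      refine hasSum_catalanConstant.summable.norm.congr fun n => ?_
      rw [norm_div, norm_pow, norm_neg, norm_one, one_pow, norm_pow, Real.norm_eq_abs,
        abs_of_nonneg (by positivity)])
  have hterm (n : ℕ) : ∫ u in Set.Ioo (0 : ℝ) 1, (-1) ^ n * (u ^ (2 * n) * log u) =
      -((-1) ^ n / (2 * (n : ℝ) + 1) ^ 2) := by
    rw [integral_const_mul, ← integral_Ioc_eq_integral_Ioo,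
      ← intervalIntegral.integral_of_le zero_le_one, integral_pow_mul_log]
    push_cast
    ring
  simp only [hterm] at hs
  rw [← hs.unique hasSum_catalanConstant.neg, intervalIntegral.integral_of_le zero_le_one,
    integral_Ioc_eq_integral_Ioo]
  refine setIntegral_congr_fun measurableSet_Ioo fun u hu => ?_
  have hg := (hasSum_geometric_of_abs_lt_one (r := -u ^ 2) (by
    rw [abs_neg, abs_of_pos (pow_pos hu.1 2)]
    exact pow_lt_one₀ hu.1.le hu.2 two_ne_zero)).mul_right (log u)
  have hg2 : HasSum (fun n : ℕ => (-1 : ℝ) ^ n * (u ^ (2 * n) * log u))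
      ((1 - -u ^ 2)⁻¹ * log u) := by
    refine hg.congr_fun fun n => ?_
    rw [neg_pow, pow_mul]
    ring
  rw [hg2.tsum_eq]
  ring

lemma intervalIntegrable_log_sin' (a b : ℝ) :
    IntervalIntegrable (fun x => log (sin x)) volume a b := intervalIntegrable_log_sin

lemma intervalIntegrable_log_cos' (a b : ℝ) :
    IntervalIntegrable (fun x => log (cos x)) volume a b := intervalIntegrable_log_cos

lemma cos_pos_of_mem_Icc_pi_div_four {x : ℝ} (hx : x ∈ Set.Icc 0 (π / 4)) : 0 < cos x :=
  cos_pos_of_mem_Ioo ⟨by linarith [hx.1, pi_pos], by linarith [hx.2, pi_pos]⟩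

lemma sin_pos_of_mem_Ioc_pi_div_four {x : ℝ} (hx : x ∈ Set.Ioc 0 (π / 4)) : 0 < sin x :=
  sin_pos_of_pos_of_lt_pi hx.1 (by linarith [hx.2, pi_pos])

/-- The substitution `u = tan x` leads to `integral_log_div_one_add_sq`. -/
lemma integral_log_sin_sub_log_cos :
    ∫ x in (0 : ℝ)..π / 4, (log (sin x) - log (cos x)) = -catalanConstant := by
  have hπ : (0 : ℝ) ≤ π / 4 := by positivity
  have htan : ContinuousOn tan (Set.Icc 0 (π / 4)) := fun x hx =>
    (continuousAt_tan.2 (cos_pos_of_mem_Icc_pi_div_four hx).ne').continuousWithinAt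
  have hsub : ∀ x ∈ Set.Ioc 0 (π / 4), ((fun u => log u / (1 + u ^ 2)) ∘ tan) x *
      (1 / cos x ^ 2) = log (sin x) - log (cos x) := by
    intro x hx
    have hc := cos_pos_of_mem_Icc_pi_div_four ⟨hx.1.le, hx.2⟩
    have hs := sin_pos_of_mem_Ioc_pi_div_four hx
    have e : 1 + tan x ^ 2 = 1 / cos x ^ 2 := by
      rw [tan_eq_sin_div_cos]
      field_simp
      linarith [sin_sq_add_cos_sq x]
    simp only [Function.comp_apply]
    rw [e, tan_eq_sin_div_cos, log_div hs.ne' hc.ne']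
    field_simp
  have h := intervalIntegral.integral_comp_mul_deriv''' (a := 0) (b := π / 4) (f := tan)
    (f' := fun x => 1 / cos x ^ 2) (g := fun u => log u / (1 + u ^ 2))
    (by rwa [Set.uIcc_of_le hπ])
    (fun x hx => by
      rw [min_eq_left hπ, max_eq_right hπ] at hx
      exact (hasDerivAt_tan
        (cos_pos_of_mem_Icc_pi_div_four ⟨hx.1.le, hx.2.le⟩).ne').hasDerivWithinAt)
    (by
      rintro _ ⟨x, hx, rfl⟩
      rw [min_eq_left hπ, max_eq_right hπ] at hx
      have ht : 0 < tan x := tan_pos_of_pos_of_lt_pi_div_two hx.1 (by linarith [hx.2, pi_pos])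
      exact ((continuousAt_log ht.ne').div (by fun_prop) (by positivity)).continuousWithinAt)
    (by
      rw [Set.uIcc_of_le hπ]
      have hsubset : tan '' Set.Icc 0 (π / 4) ⊆ Set.Icc 0 1 := by
        rintro _ ⟨x, hx, rfl⟩
        refine ⟨tan_nonneg_of_nonneg_of_le_pi_div_two hx.1 (by linarith [hx.2, pi_pos]), ?_⟩
        rw [← tan_pi_div_four]
        exact strictMonoOn_tan.monotoneOn
          ⟨by linarith [hx.1, pi_pos], by linarith [hx.2, pi_pos]⟩
          ⟨by linarith [pi_pos], by linarith [pi_pos]⟩ hx.2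
      refine IntegrableOn.mono_set ?_ hsubset
      rw [integrableOn_Icc_iff_integrableOn_Ioc,
        ← intervalIntegrable_iff_integrableOn_Ioc_of_le zero_le_one]
      refine (intervalIntegral.intervalIntegrable_log'.mul_continuousOn
        (g := fun u => (1 + u ^ 2)⁻¹) (Continuous.continuousOn ?_))
      exact Continuous.inv₀ (by fun_prop) fun u => by positivity)
    (by
      rw [Set.uIcc_of_le hπ, integrableOn_Icc_iff_integrableOn_Ioc]
      refine IntegrableOn.congr_fun ?_ (fun x hx => (hsub x hx).symm) measurableSet_Ioc
      exact (intervalIntegrable_iff_integrableOn_Ioc_of_le hπ).1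
        ((intervalIntegrable_log_sin' _ _).sub (intervalIntegrable_log_cos' _ _)))
  rw [tan_zero, tan_pi_div_four, integral_log_div_one_add_sq] at h
  rw [← h, intervalIntegral.integral_of_le hπ, intervalIntegral.integral_of_le hπ]
  exact (setIntegral_congr_fun measurableSet_Ioc hsub).symm

/-- From `sin x * cos x = sin (2 * x) / 2` and the classical integral of `log sin` over `[0, π/2]`.
Together with the difference, this determines both integrals. -/
lemma integral_log_sin_add_log_cos :
    ∫ x in (0 : ℝ)..π / 4, (log (sin x) + log (cos x)) = -(π / 2 * log 2) := by
  have hπ : (0 : ℝ) ≤ π / 4 := by positivity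
  have h1 : ∫ x in (0 : ℝ)..π / 4, (log (sin x) + log (cos x)) =
      ∫ x in (0 : ℝ)..π / 4, (log (sin (2 * x)) - log 2) := by
    rw [intervalIntegral.integral_of_le hπ, intervalIntegral.integral_of_le hπ]
    refine setIntegral_congr_fun measurableSet_Ioc fun x hx => ?_
    have hc := cos_pos_of_mem_Icc_pi_div_four ⟨hx.1.le, hx.2⟩
    have hs := sin_pos_of_mem_Ioc_pi_div_four hx
    rw [sin_two_mul, log_mul (by positivity) hc.ne', log_mul two_ne_zero hs.ne']
    ring
  have hi : IntervalIntegrable (fun x => log (sin (2 * x))) volume 0 (π / 4) := by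
    have := (intervalIntegrable_log_sin' 0 (π / 2)).comp_mul_left (c := 2)
    convert this using 1 <;> ring
  rw [h1, intervalIntegral.integral_sub hi (by simp),
    intervalIntegral.integral_comp_mul_left (fun x => log (sin x)) two_ne_zero,
    show 2 * (π / 4) = π / 2 by ring, mul_zero, integral_log_sin_zero_pi_div_two]
  simp
  ring

lemma integral_log_sin_zero_pi_div_four :
    ∫ x in (0 : ℝ)..π / 4, log (sin x) = -(catalanConstant / 2) - π / 4 * log 2 := by
  have h1 := integral_log_sin_add_log_cos
  have h2 := integral_log_sin_sub_log_cos
  rw [intervalIntegral.integral_add (intervalIntegrable_log_sin' _ _)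
    (intervalIntegrable_log_cos' _ _)] at h1
  rw [intervalIntegral.integral_sub (intervalIntegrable_log_sin' _ _)
    (intervalIntegrable_log_cos' _ _)] at h2
  linarith

lemma integral_log_cos_zero_pi_div_four :
    ∫ x in (0 : ℝ)..π / 4, log (cos x) = catalanConstant / 2 - π / 4 * log 2 := by
  have h1 := integral_log_sin_add_log_cos
  have h2 := integral_log_sin_sub_log_cos
  rw [intervalIntegral.integral_add (intervalIntegrable_log_sin' _ _)
    (intervalIntegrable_log_cos' _ _)] at h1
  rw [intervalIntegral.integral_sub (intervalIntegrable_log_sin' _ _)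
    (intervalIntegrable_log_cos' _ _)] at h2
  linarith

/-! ### The entropy integral over the angle -/

/-- Expanding the entropy gives `-2 sin² cos² log cos - 2 sin⁴ log sin`. The coefficients have means
`1/4` and `3/4` over a period; once these are removed, integration by parts leaves only
trigonometric polynomials, so the corrected integrand has an elementary primitive. The factor `sin x
* log (sin x)` is isolated for continuity at `0`. -/
lemma hasDerivAt_sin_sq_mul_binEntropy_primitive {x : ℝ} (hs : 0 < sin x) (hc : 0 < cos x) :
    HasDerivAt (fun x => sin x * cos x * (2 * cos x ^ 2 - 1) / 4 * log (cos x) +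
        (cos x - cos x * (2 * cos x ^ 2 - 1) / 4) * (sin x * log (sin x)) - x / 2 -
        sin x * cos x / 4)
      (sin x ^ 2 * binEntropy (cos x ^ 2) + 3 / 4 * log (sin x) + 1 / 4 * log (cos x)) x := by
  have h1 := hasDerivAt_sin x
  have h2 := hasDerivAt_cos x
  have hp := ((h2.pow 2).const_mul 2).sub_const 1
  have h3 := ((((h1.mul h2).mul hp).div_const 4).mul (h2.log hc.ne')).add
    ((h2.sub ((h2.mul hp).div_const 4)).mul (h1.mul (h1.log hs.ne')))
  have h4 := (h3.sub ((hasDerivAt_id x).div_const 2)).sub ((h1.mul h2).div_const 4)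
  refine (h4.congr_deriv ?_).congr_of_eventuallyEq (Eventually.of_forall fun y => ?_)
  · have e : sin x ^ 2 = 1 - cos x ^ 2 := sin_sq x
    have hb : binEntropy (cos x ^ 2) =
        -(2 * cos x ^ 2 * log (cos x)) - 2 * sin x ^ 2 * log (sin x) := by
      rw [binEntropy_eq_negMulLog_add_negMulLog_one_sub, ← sin_sq, negMulLog, negMulLog, log_pow,
        log_pow]
      push_cast
      ring
    rw [hb]
    simp only [Pi.mul_apply, Pi.pow_apply, Pi.sub_apply]
    generalize log (sin x) = ls at *
    generalize log (cos x) = lc at *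
    field_simp
    generalize sin x = s at *
    generalize cos x = c at *
    clear * - e
    grind
  · simp

lemma integral_sin_sq_mul_binEntropy :
    ∫ x in (0 : ℝ)..π / 4, sin x ^ 2 * binEntropy (cos x ^ 2) =
      π / 4 * log 2 - π / 8 - 1 / 8 + catalanConstant / 4 - log 2 / 4 := by
  have hπ : (0 : ℝ) ≤ π / 4 := by positivity
  have hcont : Continuous fun x => sin x ^ 2 * binEntropy (cos x ^ 2) := by fun_prop
  have hi1 := (intervalIntegrable_log_sin' 0 (π / 4)).const_mul (3 / 4)
  have hi2 := (intervalIntegrable_log_cos' 0 (π / 4)).const_mul (1 / 4)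
  have h := intervalIntegral.integral_eq_sub_of_hasDerivAt_of_le hπ
    (f := fun x => sin x * cos x * (2 * cos x ^ 2 - 1) / 4 * log (cos x) +
        (cos x - cos x * (2 * cos x ^ 2 - 1) / 4) * (sin x * log (sin x)) - x / 2 -
        sin x * cos x / 4)
    (by
      have h1 : ContinuousOn (fun x => log (cos x)) (Set.Icc 0 (π / 4)) :=
        continuous_cos.continuousOn.log fun x hx => (cos_pos_of_mem_Icc_pi_div_four hx).ne'
      have h2 : Continuous fun x => sin x * log (sin x) := continuous_mul_log.comp continuous_sin
      fun_prop)
    (fun x hx => hasDerivAt_sin_sq_mul_binEntropy_primitive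
      (sin_pos_of_mem_Ioc_pi_div_four ⟨hx.1, hx.2.le⟩)
      (cos_pos_of_mem_Icc_pi_div_four ⟨hx.1.le, hx.2.le⟩))
    (((hcont.intervalIntegrable _ _).add hi1).add hi2)
  rw [intervalIntegral.integral_add ((hcont.intervalIntegrable _ _).add hi1) hi2,
    intervalIntegral.integral_add (hcont.intervalIntegrable _ _) hi1,
    intervalIntegral.integral_const_mul, intervalIntegral.integral_const_mul,
    integral_log_sin_zero_pi_div_four, integral_log_cos_zero_pi_div_four] at h
  have hsq : (√2 / 2 : ℝ) ^ 2 = 1 / 2 := by rw [div_pow]; norm_num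
  have hl : log (√2 / 2) = -(log 2 / 2) := by
    rw [log_div (by positivity) two_ne_zero, log_sqrt (by norm_num)]
    ring
  simp only [sin_zero, cos_zero, log_one, sin_pi_div_four, cos_pi_div_four, hl, hsq, zero_mul,
    mul_zero] at h
  have hss : √2 / 2 * (√2 / 2) = (1 / 2 : ℝ) := by rw [← sq, hsq]
  linear_combination h + (-(log 2 / 2) - 1 / 4) * hss

/-- The range splits at `π / 4`, where `cos² x = 1/2`: before it the maximum is `cos² x`, after it
the entropy is constantly `log 2`. -/
lemma integral_sin_sq_mul_binEntropy_max :
    ∫ x in (0 : ℝ)..π / 2, sin x ^ 2 * binEntropy (max (cos x ^ 2) 2⁻¹) =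
      π / 4 * (3 / 2 * log 2 - 1 / 2 - 1 / (2 * π) + catalanConstant / π) := by
  have hcont : Continuous fun x => sin x ^ 2 * binEntropy (max (cos x ^ 2) 2⁻¹) := by fun_prop
  have hsq : (√2 / 2 : ℝ) ^ 2 = 2⁻¹ := by rw [div_pow]; norm_num
  rw [← intervalIntegral.integral_add_adjacent_intervals (b := π / 4)
    (hcont.intervalIntegrable _ _) (hcont.intervalIntegrable _ _)]
  have h1 : ∫ x in (0 : ℝ)..π / 4, sin x ^ 2 * binEntropy (max (cos x ^ 2) 2⁻¹) =
      ∫ x in (0 : ℝ)..π / 4, sin x ^ 2 * binEntropy (cos x ^ 2) := by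
    refine intervalIntegral.integral_congr fun x hx => ?_
    rw [Set.uIcc_of_le (by positivity)] at hx
    have h : √2 / 2 ≤ cos x := by
      rw [← cos_pi_div_four]
      exact cos_le_cos_of_nonneg_of_le_pi hx.1 (by linarith [pi_pos]) hx.2
    rw [max_eq_left]
    rw [← hsq]
    gcongr
  have h2 : ∫ x in (π / 4)..π / 2, sin x ^ 2 * binEntropy (max (cos x ^ 2) 2⁻¹) =
      ∫ x in (π / 4)..π / 2, sin x ^ 2 * log 2 := by
    refine intervalIntegral.integral_congr fun x hx => ?_
    rw [Set.uIcc_of_le (by linarith [pi_pos])] at hx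
    have h : cos x ≤ √2 / 2 := by
      rw [← cos_pi_div_four]
      exact cos_le_cos_of_nonneg_of_le_pi (by positivity) (by linarith [pi_pos, hx.2]) hx.1
    have h0 : 0 ≤ cos x := cos_nonneg_of_mem_Icc ⟨by linarith [pi_pos, hx.1], hx.2⟩
    rw [max_eq_right, binEntropy_two_inv]
    rw [← hsq]
    gcongr
  have hss : √2 / 2 * (√2 / 2) = (1 / 2 : ℝ) := by rw [← sq, hsq]; norm_num
  rw [h1, h2, integral_sin_sq_mul_binEntropy, intervalIntegral.integral_mul_const,
    integral_sin_sq, sin_pi_div_four, cos_pi_div_four, hss, cos_pi_div_two]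
  field_simp
  ring

/-! ### Trigonometric moments and the numerical value -/

lemma integral_sin_sq_mul_cos_sq_pow (k : ℕ) :
    ∫ x in (0 : ℝ)..π / 2, sin x ^ 2 * (cos x ^ 2) ^ k =
      (∫ x in (0 : ℝ)..π / 2, cos x ^ (2 * k)) / (2 * k + 2) := by
  have h := integral_cos_pow (a := 0) (b := π / 2) (n := 2 * k)
  have h2 : ∫ x in (0 : ℝ)..π / 2, sin x ^ 2 * (cos x ^ 2) ^ k =
      (∫ x in (0 : ℝ)..π / 2, cos x ^ (2 * k)) - ∫ x in (0 : ℝ)..π / 2, cos x ^ (2 * k + 2) := by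
    rw [← intervalIntegral.integral_sub
      (Continuous.intervalIntegrable (by fun_prop) _ _)
      (Continuous.intervalIntegrable (by fun_prop) _ _)]
    refine intervalIntegral.integral_congr fun x _ => ?_
    rw [sin_sq]
    ring
  rw [h2, h]
  have : (2 * (k : ℝ) + 2) ≠ 0 := by positivity
  simp
  field_simp
  ring

/-- Wallis' reduction in the form of the recursion that the Haar moments of `T` satisfy. -/
lemma integral_sin_sq_mul_cos_sq_pow_succ (k : ℕ) :
    (2 * k + 4) * ∫ x in (0 : ℝ)..π / 2, sin x ^ 2 * (cos x ^ 2) ^ (k + 1) =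
      (2 * k + 1) * ∫ x in (0 : ℝ)..π / 2, sin x ^ 2 * (cos x ^ 2) ^ k := by
  rw [integral_sin_sq_mul_cos_sq_pow, integral_sin_sq_mul_cos_sq_pow,
    show 2 * (k + 1) = 2 * k + 2 by ring, integral_cos_pow]
  have h1 : (2 * (k : ℝ) + 2) ≠ 0 := by positivity
  have h2 : (2 * ((k : ℝ) + 1) + 2) ≠ 0 := by positivity
  simp
  field_simp
  ring

lemma abs_average_sub_lt :
    |3 / 2 * log 2 - 1 / 2 - 1 / (2 * π) + catalanConstant / π - 0.672| < 0.0005 := by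
  have hC := abs_lt.1 abs_catalanConstant_sub_lt
  -- Collecting the multiples of `1 / π` leaves one positive numerator, so bounds for `π` and `C`
  -- combine directly.
  have e : 3 / 2 * log 2 - 1 / 2 - 1 / (2 * π) + catalanConstant / π =
      3 / 2 * log 2 - 1 / 2 + (catalanConstant - 1 / 2) / π := by
    field_simp
    ring
  have h1 : (catalanConstant - 1 / 2) / π < 0.1326 := by
    rw [div_lt_iff₀ pi_pos]
    linarith [pi_gt_d4]
  have h2 : 0.1322 < (catalanConstant - 1 / 2) / π := by
    rw [lt_div_iff₀ pi_pos]
    linarith [pi_lt_d4]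
  rw [e, abs_lt]
  constructor <;> linarith [log_two_gt_d9, log_two_lt_d9]

/-! ### Haar invariance along one-parameter subgroups -/

section

/-- The integral of the derivative of a bounded function along a one-parameter family of left
translations vanishes. -/
lemma integral_translation_deriv_eq_zero {G : Type*} [Group G] [TopologicalSpace G]
    [MeasurableSpace G] [BorelSpace G] [ContinuousMul G] (m : Measure G)
    [m.IsMulLeftInvariant] [IsFiniteMeasure m] (R : ℝ → G) (hR : R 0 = 1) {f f' : G → ℝ} {C : ℝ}
    (hf : Continuous f) (hf' : Continuous f') (hC : ∀ U, |f U| ≤ C) (hC' : ∀ U, |f' U| ≤ C)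
    (hd : ∀ U t, HasDerivAt (fun t => f (R t * U)) (f' (R t * U)) t) :
    ∫ U, f' U ∂m = 0 := by
  have h := hasDerivAt_integral_of_dominated_loc_of_deriv_le (μ := m) (x₀ := (0 : ℝ))
    (F := fun t U => f (R t * U)) (F' := fun t U => f' (R t * U)) (bound := fun _ => C)
    univ_mem
    (Eventually.of_forall fun t =>
      (hf.comp (continuous_const_mul (R t))).measurable.aestronglyMeasurable)
    (Integrable.of_bound
      (hf.comp (continuous_const_mul (R 0))).measurable.aestronglyMeasurable C
      (Eventually.of_forall fun U => hC _))
    (hf'.comp (continuous_const_mul (R 0))).measurable.aestronglyMeasurable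
    (Eventually.of_forall fun U t _ => hC' _) (integrable_const C)
    (Eventually.of_forall fun U t _ => hd U t)
  have h2 := h.2
  -- By left invariance the integral of `f (R t * U)` is constant in `t`, so its derivative at `0`
  -- is both `∫ f'` and zero.
  simp only [integral_mul_left_eq_self f, hR, one_mul] at h2
  exact h2.unique (hasDerivAt_const _ _)

/-- The squared modulus of the component `tr (W U) / 2`. -/
noncomputable def compSq (W : Matrix (Fin 2) (Fin 2) ℂ) (U : Matrix.unitaryGroup (Fin 2) ℂ) : ℝ :=
  ‖(W * (U : Matrix (Fin 2) (Fin 2) ℂ)).trace‖ ^ 2 / 4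

/-- The correlation of `tr U / 2` and `tr (W U) / 2`. -/
noncomputable def compCross (W : Matrix (Fin 2) (Fin 2) ℂ)
    (U : Matrix.unitaryGroup (Fin 2) ℂ) : ℝ :=
  ((U : Matrix (Fin 2) (Fin 2) ℂ).trace *
    star (W * (U : Matrix (Fin 2) (Fin 2) ℂ)).trace).re / 4

lemma compSq_nonneg (W : Matrix (Fin 2) (Fin 2) ℂ) (U : Matrix.unitaryGroup (Fin 2) ℂ) :
    0 ≤ compSq W U := by unfold compSq; positivity

lemma continuous_normTraceSq : Continuous normTraceSq := by
  unfold normTraceSq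
  have : Continuous fun U : Matrix.unitaryGroup (Fin 2) ℂ =>
    (U : Matrix (Fin 2) (Fin 2) ℂ).trace := continuous_subtype_val.matrix_trace
  fun_prop

lemma continuous_compSq (W : Matrix (Fin 2) (Fin 2) ℂ) : Continuous (compSq W) := by
  unfold compSq
  have : Continuous fun U : Matrix.unitaryGroup (Fin 2) ℂ =>
    (W * (U : Matrix (Fin 2) (Fin 2) ℂ)).trace :=
    (continuous_const.matrix_mul continuous_subtype_val).matrix_trace
  fun_prop

lemma continuous_compCross (W : Matrix (Fin 2) (Fin 2) ℂ) : Continuous (compCross W) := by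
  unfold compCross
  have h1 : Continuous fun U : Matrix.unitaryGroup (Fin 2) ℂ =>
    (W * (U : Matrix (Fin 2) (Fin 2) ℂ)).trace :=
    (continuous_const.matrix_mul continuous_subtype_val).matrix_trace
  have h2 : Continuous fun U : Matrix.unitaryGroup (Fin 2) ℂ =>
    (U : Matrix (Fin 2) (Fin 2) ℂ).trace := continuous_subtype_val.matrix_trace
  exact (Complex.continuous_re.comp (h2.mul h1.star)).div_const 4

lemma rotation_mem {W : Matrix (Fin 2) (Fin 2) ℂ} (hW : W * W = -1) (hs : star W = -W) (t : ℝ) :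
    (cos t : ℂ) • (1 : Matrix (Fin 2) (Fin 2) ℂ) + (sin t : ℂ) • W ∈
      Matrix.unitaryGroup (Fin 2) ℂ := by
  rw [Matrix.mem_unitaryGroup_iff]
  have e : (cos t : ℂ) * cos t + (sin t : ℂ) * sin t = 1 := by
    exact_mod_cast (by linarith [sin_sq_add_cos_sq t] : cos t * cos t + sin t * sin t = 1)
  simp only [star_add, star_smul, hs, star_one, RCLike.star_def, Complex.conj_ofReal, smul_neg,
    mul_add, add_mul, mul_neg, Matrix.smul_mul, Matrix.mul_smul, mul_one, one_mul, hW, smul_smul]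
  calc _ = ((cos t : ℂ) * cos t + (sin t : ℂ) * sin t) • (1 : Matrix (Fin 2) (Fin 2) ℂ) := by module
    _ = 1 := by rw [e, one_smul]

variable {W : Matrix (Fin 2) (Fin 2) ℂ} (hW : W * W = -1) (hs : star W = -W)

/-- The one-parameter subgroup `exp (t W) = cos t + (sin t) W` for a skew-hermitian square root `W`
of `-1`. -/
noncomputable def rotation (hW : W * W = -1) (hs : star W = -W) (t : ℝ) :
    Matrix.unitaryGroup (Fin 2) ℂ := ⟨_, rotation_mem hW hs t⟩

lemma trace_rotation_mul (t : ℝ) (U : Matrix.unitaryGroup (Fin 2) ℂ) :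
    ((rotation hW hs t * U : Matrix.unitaryGroup (Fin 2) ℂ) : Matrix (Fin 2) (Fin 2) ℂ).trace =
      cos t * (U : Matrix (Fin 2) (Fin 2) ℂ).trace +
        sin t * (W * (U : Matrix (Fin 2) (Fin 2) ℂ)).trace := by
  simp [rotation, add_mul]

lemma trace_mul_rotation_mul (t : ℝ) (U : Matrix.unitaryGroup (Fin 2) ℂ) :
    (W * ((rotation hW hs t * U : Matrix.unitaryGroup (Fin 2) ℂ) :
      Matrix (Fin 2) (Fin 2) ℂ)).trace =
      cos t * (W * (U : Matrix (Fin 2) (Fin 2) ℂ)).trace -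
        sin t * (U : Matrix (Fin 2) (Fin 2) ℂ).trace := by
  simp [rotation, add_mul, mul_add, ← mul_assoc, hW, sub_eq_add_neg]

/-- Left translation by `exp (t W)` rotates the pair `(tr U, tr (W U)) / 2` by the angle `t`;
`normTraceSq`, `compCross` and `compSq` are the entries of its real Gram matrix and transform
accordingly. -/
lemma normTraceSq_rotation_mul (t : ℝ) (U : Matrix.unitaryGroup (Fin 2) ℂ) :
    normTraceSq (rotation hW hs t * U) = cos t ^ 2 * normTraceSq U +
      2 * cos t * sin t * compCross W U + sin t ^ 2 * compSq W U := by
  simp only [normTraceSq, compCross, compSq, trace_rotation_mul, Complex.sq_norm,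
    Complex.normSq_apply, RCLike.star_def, Complex.mul_re, Complex.mul_im, Complex.add_re,
    Complex.add_im, Complex.conj_re, Complex.conj_im, Complex.ofReal_re, Complex.ofReal_im]
  ring

lemma compCross_rotation_mul (t : ℝ) (U : Matrix.unitaryGroup (Fin 2) ℂ) :
    compCross W (rotation hW hs t * U) = cos t * sin t * (compSq W U - normTraceSq U) +
      (cos t ^ 2 - sin t ^ 2) * compCross W U := by
  simp only [normTraceSq, compCross, compSq, trace_rotation_mul, trace_mul_rotation_mul,
    Complex.sq_norm,
    Complex.normSq_apply, RCLike.star_def, Complex.mul_re, Complex.mul_im, Complex.add_re,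
    Complex.add_im, Complex.sub_re, Complex.sub_im,
    Complex.conj_re, Complex.conj_im, Complex.ofReal_re, Complex.ofReal_im]
  ring

lemma compSq_rotation_mul (t : ℝ) (U : Matrix.unitaryGroup (Fin 2) ℂ) :
    compSq W (rotation hW hs t * U) = sin t ^ 2 * normTraceSq U -
      2 * cos t * sin t * compCross W U + cos t ^ 2 * compSq W U := by
  simp only [normTraceSq, compCross, compSq, trace_mul_rotation_mul, Complex.sq_norm,
    Complex.normSq_apply, RCLike.star_def, Complex.mul_re, Complex.mul_im, Complex.sub_re,
    Complex.sub_im, Complex.conj_re, Complex.conj_im, Complex.ofReal_re, Complex.ofReal_im]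
  ring

lemma hasDerivAt_normTraceSq_rotation (U : Matrix.unitaryGroup (Fin 2) ℂ) (t : ℝ) :
    HasDerivAt (fun t => normTraceSq (rotation hW hs t * U))
      (2 * compCross W (rotation hW hs t * U)) t := by
  simp only [normTraceSq_rotation_mul, compCross_rotation_mul]
  have hc := hasDerivAt_cos t
  have hsn := hasDerivAt_sin t
  refine ((((hc.pow 2).mul_const (normTraceSq U)).add
    (((hc.const_mul 2).mul hsn).mul_const (compCross W U))).add
      ((hsn.pow 2).mul_const (compSq W U))).congr_deriv ?_
  simp
  ring

lemma hasDerivAt_compCross_rotation (U : Matrix.unitaryGroup (Fin 2) ℂ) (t : ℝ) :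
    HasDerivAt (fun t => compCross W (rotation hW hs t * U))
      (compSq W (rotation hW hs t * U) - normTraceSq (rotation hW hs t * U)) t := by
  simp only [normTraceSq_rotation_mul, compCross_rotation_mul, compSq_rotation_mul]
  have hc := hasDerivAt_cos t
  have hsn := hasDerivAt_sin t
  refine (((hc.mul hsn).mul_const (compSq W U - normTraceSq U)).add
    (((hc.pow 2).sub (hsn.pow 2)).mul_const (compCross W U))).congr_deriv ?_
  simp
  ring

/-- The equality case of Cauchy–Schwarz: `hreal` says that the two traces have the same phase up to
sign, so nothing is lost in taking the real part. -/
lemma compCross_sq (hreal : ∀ U : Matrix.unitaryGroup (Fin 2) ℂ,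
      ((U : Matrix (Fin 2) (Fin 2) ℂ).trace *
        star (W * (U : Matrix (Fin 2) (Fin 2) ℂ)).trace).im = 0)
    (U : Matrix.unitaryGroup (Fin 2) ℂ) :
    compCross W U ^ 2 = normTraceSq U * compSq W U := by
  have h := hreal U
  simp only [normTraceSq, compCross, compSq, Complex.sq_norm]
  have h2 := Complex.normSq_apply ((U : Matrix (Fin 2) (Fin 2) ℂ).trace *
        star (W * (U : Matrix (Fin 2) (Fin 2) ℂ)).trace)
  rw [h, map_mul, RCLike.star_def, Complex.normSq_conj] at h2
  rw [RCLike.star_def]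
  linear_combination -h2 / 16

/-- Write `T`, `Q`, `S` for `normTraceSq`, `compCross W`, `compSq W`. Along the rotation `T' = 2Q`
and `Q' = S - T`, so `(Q T ^ k)' = (S - T) T ^ k + 2k Q² T ^ (k - 1)`, and `Q² = T S` turns this
into the integrand. -/
lemma integral_compSq_mul_normTraceSq_pow
    [MeasurableSpace (Matrix.unitaryGroup (Fin 2) ℂ)] [BorelSpace (Matrix.unitaryGroup (Fin 2) ℂ)]
    (m : Measure (Matrix.unitaryGroup (Fin 2) ℂ)) [m.IsMulLeftInvariant] [IsFiniteMeasure m]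
    (hW : W * W = -1) (hs : star W = -W)
    (hreal : ∀ U : Matrix.unitaryGroup (Fin 2) ℂ,
      ((U : Matrix (Fin 2) (Fin 2) ℂ).trace *
        star (W * (U : Matrix (Fin 2) (Fin 2) ℂ)).trace).im = 0)
    (hle : ∀ U, compSq W U ≤ 1) (k : ℕ) :
    ∫ U, ((2 * k + 1) * (compSq W U * normTraceSq U ^ k) - normTraceSq U ^ (k + 1)) ∂m = 0 := by
  have hT := continuous_normTraceSq
  have hS := continuous_compSq W
  have hQ := continuous_compCross W
  have hp (U) (k : ℕ) : 0 ≤ normTraceSq U ^ k ∧ normTraceSq U ^ k ≤ 1 :=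
    ⟨pow_nonneg (normTraceSq_nonneg U) k,
      pow_le_one₀ (normTraceSq_nonneg U) (normTraceSq_le_one U)⟩
  refine integral_translation_deriv_eq_zero m (rotation hW hs)
    (Subtype.ext (by simp [rotation])) (f := fun U => compCross W U * normTraceSq U ^ k)
    -- Since `T`, `S` and `|Q|` are at most `1`, the derivative lies between `-1` and `2k + 1`.
    (C := 2 * k + 2) (by fun_prop) (by fun_prop) (fun U => ?_) (fun U => ?_) (fun U t => ?_)
  · have h1 : |compCross W U| ≤ 1 := by
      rw [← sq_le_one_iff_abs_le_one, compCross_sq hreal]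
      exact mul_le_one₀ (normTraceSq_le_one U) (compSq_nonneg W U) (hle U)
    rw [abs_mul, abs_of_nonneg (hp U k).1]
    calc _ ≤ (1 : ℝ) * 1 := mul_le_mul h1 (hp U k).2 (hp U k).1 zero_le_one
      _ ≤ _ := by linarith [k.cast_nonneg (α := ℝ)]
  · have h1 : compSq W U * normTraceSq U ^ k ≤ 1 := mul_le_one₀ (hle U) (hp U k).1 (hp U k).2
    have h0 : 0 ≤ compSq W U * normTraceSq U ^ k := mul_nonneg (compSq_nonneg W U) (hp U k).1
    have hk := k.cast_nonneg (α := ℝ)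
    have h2 : (2 * (k : ℝ) + 1) * (compSq W U * normTraceSq U ^ k) ≤ (2 * k + 1) * 1 := by gcongr
    have h3 : 0 ≤ (2 * (k : ℝ) + 1) * (compSq W U * normTraceSq U ^ k) := by positivity
    have h4 := hp U (k + 1)
    rw [abs_le]
    constructor <;> linarith
  · refine ((hasDerivAt_compCross_rotation hW hs U t).mul
      ((hasDerivAt_normTraceSq_rotation hW hs U t).pow k)).congr_deriv ?_
    have hq := compCross_sq hreal (rotation hW hs t * U)
    rcases k with _ | k
    · simp
    · simp only [Pi.pow_apply]
      push_cast
      linear_combination (2 * (k + 1) * normTraceSq (rotation hW hs t * U) ^ k) * hq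

end

/-! ### The three Pauli directions and the moments of the trace -/

section

/-- Parseval's identity: the identity and `i` times the Pauli matrices, up to sign, form an
orthogonal basis for the Hilbert–Schmidt product, and a unitary has squared norm `2`. -/
lemma sum_compSq_pauli (U : Matrix.unitaryGroup (Fin 2) ℂ) :
    normTraceSq U + compSq !![Complex.I, 0; 0, -Complex.I] U + compSq !![0, 1; -1, 0] U +
      compSq !![0, Complex.I; Complex.I, 0] U = 1 := by
  have r0 := unitary_row_sum U.2 0
  have r1 := unitary_row_sum U.2 1
  simp only [normTraceSq, compSq, Matrix.trace_fin_two, Matrix.mul_apply, Fin.sum_univ_two,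
    Complex.sq_norm, Complex.normSq_apply, Matrix.of_apply, Matrix.cons_val', Matrix.cons_val_zero,
    Matrix.cons_val_one, Matrix.cons_val_fin_one, Complex.add_re, Complex.add_im, Complex.mul_re,
    Complex.mul_im, Complex.neg_re, Complex.neg_im, Complex.I_re, Complex.I_im, Complex.zero_re,
    Complex.zero_im, Complex.one_re, Complex.one_im] at r0 r1 ⊢
  linear_combination r0 / 2 + r1 / 2

lemma unitary_row_orthogonal {M : Matrix (Fin 2) (Fin 2) ℂ}
    (hM : M ∈ Matrix.unitaryGroup (Fin 2) ℂ) :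
    M 0 0 * star (M 1 0) + M 0 1 * star (M 1 1) = 0 := by
  have h := congrFun (congrFun (Matrix.mem_unitaryGroup_iff.1 hM) 0) 1
  simpa [Matrix.mul_apply, Fin.sum_univ_two] using h

lemma unitary_col_orthogonal {M : Matrix (Fin 2) (Fin 2) ℂ}
    (hM : M ∈ Matrix.unitaryGroup (Fin 2) ℂ) :
    star (M 0 0) * M 0 1 + star (M 1 0) * M 1 1 = 0 := by
  have h := congrFun (congrFun (Matrix.mem_unitaryGroup_iff'.1 hM) 0) 1
  simpa [Matrix.mul_apply, Fin.sum_univ_two] using h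

/-- An element of `U(2)` is a phase times an element of `SU(2)`, whose coordinates in this basis are
real (a unit quaternion); the phase cancels in the product. The computation needs only the row and
column relations. -/
lemma im_trace_mul_star_eq_zero (U : Matrix.unitaryGroup (Fin 2) ℂ) :
    ((U : Matrix (Fin 2) (Fin 2) ℂ).trace * star (!![Complex.I, 0; 0, -Complex.I] *
      (U : Matrix (Fin 2) (Fin 2) ℂ)).trace).im = 0 ∧
    ((U : Matrix (Fin 2) (Fin 2) ℂ).trace * star (!![0, 1; -1, 0] *
      (U : Matrix (Fin 2) (Fin 2) ℂ)).trace).im = 0 ∧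
    ((U : Matrix (Fin 2) (Fin 2) ℂ).trace * star (!![0, Complex.I; Complex.I, 0] *
      (U : Matrix (Fin 2) (Fin 2) ℂ)).trace).im = 0 := by
  have r1 := unitary_row_sum U.2 1
  have c0 := unitary_col_sum U.2 0
  have ro := unitary_row_orthogonal U.2
  have co := unitary_col_orthogonal U.2
  have rore := congrArg Complex.re ro
  have roim := congrArg Complex.im ro
  have core := congrArg Complex.re co
  have coim := congrArg Complex.im co
  simp only [Matrix.trace_fin_two, Matrix.mul_apply, Fin.sum_univ_two, RCLike.star_def,
    Complex.sq_norm, Complex.normSq_apply, Matrix.of_apply, Matrix.cons_val', Matrix.cons_val_zero,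
    Matrix.cons_val_one, Matrix.cons_val_fin_one, Complex.add_re, Complex.add_im, Complex.mul_re,
    Complex.mul_im, Complex.neg_re, Complex.neg_im, Complex.I_re, Complex.I_im, Complex.zero_re,
    Complex.zero_im, Complex.one_re, Complex.one_im, Complex.conj_re, Complex.conj_im]
    at r1 c0 rore roim core coim ⊢
  refine ⟨?_, ?_, ?_⟩
  · linear_combination r1 - c0
  · linear_combination roim + coim
  · linear_combination -rore - core

lemma compSq_pauli_le_one (U : Matrix.unitaryGroup (Fin 2) ℂ) :
    compSq !![Complex.I, 0; 0, -Complex.I] U ≤ 1 ∧ compSq !![0, 1; -1, 0] U ≤ 1 ∧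
      compSq !![0, Complex.I; Complex.I, 0] U ≤ 1 := by
  have h := sum_compSq_pauli U
  have h0 := normTraceSq_nonneg U
  have h1 := compSq_nonneg !![Complex.I, 0; 0, -Complex.I] U
  have h2 := compSq_nonneg !![0, 1; -1, 0] U
  have h3 := compSq_nonneg !![0, Complex.I; Complex.I, 0] U
  refine ⟨?_, ?_, ?_⟩ <;> linarith

lemma abs_normTraceSq_pow_le_one (U : Matrix.unitaryGroup (Fin 2) ℂ) (k : ℕ) :
    |normTraceSq U ^ k| ≤ 1 := by
  rw [abs_of_nonneg (pow_nonneg (normTraceSq_nonneg U) k)]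
  exact pow_le_one₀ (normTraceSq_nonneg U) (normTraceSq_le_one U)

section Haar

variable [MeasurableSpace (Matrix.unitaryGroup (Fin 2) ℂ)]
  [BorelSpace (Matrix.unitaryGroup (Fin 2) ℂ)]
  (m : Measure (Matrix.unitaryGroup (Fin 2) ℂ))

lemma integrable_of_continuous_of_bound [IsFiniteMeasure m]
    {f : Matrix.unitaryGroup (Fin 2) ℂ → ℝ} (hf : Continuous f) {C : ℝ} (hC : ∀ U, |f U| ≤ C) :
    Integrable f m :=
  Integrable.of_bound hf.measurable.aestronglyMeasurable C (Eventually.of_forall hC)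

lemma integrable_normTraceSq_pow [IsFiniteMeasure m] (k : ℕ) :
    Integrable (fun U => normTraceSq U ^ k) m :=
  integrable_of_continuous_of_bound m (continuous_normTraceSq.pow k)
    fun U => abs_normTraceSq_pow_le_one U k

lemma integrable_compSq_mul_normTraceSq_pow [IsFiniteMeasure m] {W : Matrix (Fin 2) (Fin 2) ℂ}
    (hle : ∀ U, compSq W U ≤ 1) (k : ℕ) :
    Integrable (fun U => compSq W U * normTraceSq U ^ k) m := by
  refine integrable_of_continuous_of_bound m (C := 1)
    ((continuous_compSq W).mul (continuous_normTraceSq.pow k)) fun U => ?_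
  rw [abs_mul, abs_of_nonneg (compSq_nonneg W U)]
  exact mul_le_one₀ (hle U) (abs_nonneg _) (abs_normTraceSq_pow_le_one U k)

/-- The recursion satisfied by the moments of `|tr U|² / 4` under a Haar measure on `U(2)`. -/
lemma integral_normTraceSq_pow_succ [m.IsMulLeftInvariant] [IsFiniteMeasure m] (k : ℕ) :
    (2 * k + 4) * ∫ U, normTraceSq U ^ (k + 1) ∂m = (2 * k + 1) * ∫ U, normTraceSq U ^ k ∂m := by
  have key {W : Matrix (Fin 2) (Fin 2) ℂ} (hW : W * W = -1) (hs : star W = -W)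
      (hreal : ∀ U : Matrix.unitaryGroup (Fin 2) ℂ,
        ((U : Matrix (Fin 2) (Fin 2) ℂ).trace *
          star (W * (U : Matrix (Fin 2) (Fin 2) ℂ)).trace).im = 0)
      (hle : ∀ U, compSq W U ≤ 1) :
      (2 * k + 1) * ∫ U, compSq W U * normTraceSq U ^ k ∂m = ∫ U, normTraceSq U ^ (k + 1) ∂m := by
    have h := integral_compSq_mul_normTraceSq_pow m hW hs hreal hle k
    rw [integral_sub ((integrable_compSq_mul_normTraceSq_pow m hle k).const_mul _)
      (integrable_normTraceSq_pow m _), integral_const_mul] at h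
    linarith
  have k1 := key (W := !![Complex.I, 0; 0, -Complex.I])
    (by ext i j; fin_cases i <;> fin_cases j <;> simp)
    (by ext i j; fin_cases i <;> fin_cases j <;> simp)
    (fun U => (im_trace_mul_star_eq_zero U).1) (fun U => (compSq_pauli_le_one U).1)
  have k2 := key (W := !![0, 1; -1, 0])
    (by ext i j; fin_cases i <;> fin_cases j <;> simp)
    (by ext i j; fin_cases i <;> fin_cases j <;> simp)
    (fun U => (im_trace_mul_star_eq_zero U).2.1) (fun U => (compSq_pauli_le_one U).2.1)
  have k3 := key (W := !![0, Complex.I; Complex.I, 0])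
    (by ext i j; fin_cases i <;> fin_cases j <;> simp)
    (by ext i j; fin_cases i <;> fin_cases j <;> simp)
    (fun U => (im_trace_mul_star_eq_zero U).2.2) (fun U => (compSq_pauli_le_one U).2.2)
  have i1 := integrable_compSq_mul_normTraceSq_pow m (fun U => (compSq_pauli_le_one U).1) k
  have i2 := integrable_compSq_mul_normTraceSq_pow m (fun U => (compSq_pauli_le_one U).2.1) k
  have i3 := integrable_compSq_mul_normTraceSq_pow m (fun U => (compSq_pauli_le_one U).2.2) k
  -- Multiply Parseval's identity by `T ^ k`. Each of the three directions contributes `1 / (2k +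
  -- 1)` times the next moment, which gives the factor `1 + 3 / (2k + 1) = (2k + 4) / (2k + 1)`.
  have hsum : ∫ U, normTraceSq U ^ k ∂m = ∫ U, (normTraceSq U ^ (k + 1) +
      compSq !![Complex.I, 0; 0, -Complex.I] U * normTraceSq U ^ k +
      compSq !![0, 1; -1, 0] U * normTraceSq U ^ k +
      compSq !![0, Complex.I; Complex.I, 0] U * normTraceSq U ^ k) ∂m := by
    congr 1 with U
    linear_combination (-normTraceSq U ^ k) * sum_compSq_pauli U
  have i01 : Integrable (fun U => normTraceSq U ^ (k + 1) +
      compSq !![Complex.I, 0; 0, -Complex.I] U * normTraceSq U ^ k) m :=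
    (integrable_normTraceSq_pow m _).add i1
  have i02 : Integrable (fun U => normTraceSq U ^ (k + 1) +
      compSq !![Complex.I, 0; 0, -Complex.I] U * normTraceSq U ^ k +
      compSq !![0, 1; -1, 0] U * normTraceSq U ^ k) m := i01.add i2
  rw [integral_add i02 i3, integral_add i01 i2,
    integral_add (integrable_normTraceSq_pow m _) i1] at hsum
  rw [hsum]
  linear_combination -k1 - k2 - k3

/-- Both sides obey the same recursion; total mass one at `k = 0` fixes the constant `4 / π`. -/
lemma integral_normTraceSq_pow [m.IsMulLeftInvariant] [IsProbabilityMeasure m] (k : ℕ) :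
    ∫ U, normTraceSq U ^ k ∂m =
      4 / π * ∫ x in (0 : ℝ)..π / 2, sin x ^ 2 * (cos x ^ 2) ^ k := by
  induction k with
  | zero =>
    simp only [pow_zero, mul_one, integral_sin_sq]
    simp
    field_simp
    norm_num
  | succ k ih =>
    have h1 := integral_normTraceSq_pow_succ m k
    have h2 := integral_sin_sq_mul_cos_sq_pow_succ k
    have hk : (2 * (k : ℝ) + 4) ≠ 0 := by positivity
    refine mul_left_cancel₀ hk ?_
    rw [h1, ih]
    linear_combination (-4 / π) * h2

end Haar

/-! ### From moments to continuous functions, and the average -/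

/-- Equality of moments on `[0, 1]` implies equality of the integrals of continuous functions, one
of the two measures carrying a weight. -/
lemma integral_comp_eq_of_moments {α β : Type*} [MeasurableSpace α] [MeasurableSpace β]
    {μ : Measure α} {ν : Measure β} [IsProbabilityMeasure μ] {X : α → ℝ} {Y w : β → ℝ}
    (hX : ∀ a, X a ∈ Set.Icc (0 : ℝ) 1) (hY : ∀ b, Y b ∈ Set.Icc (0 : ℝ) 1)
    (hXm : Measurable X) (hYm : Measurable Y) (hw : Integrable w ν)
    (h : ∀ k : ℕ, ∫ a, X a ^ k ∂μ = ∫ b, w b * Y b ^ k ∂ν) {g : ℝ → ℝ} (hg : Continuous g) :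
    ∫ a, g (X a) ∂μ = ∫ b, w b * g (Y b) ∂ν := by
  have iX {f : ℝ → ℝ} (hf : Continuous f) : Integrable (fun a => f (X a)) μ := by
    obtain ⟨C, hC⟩ := isCompact_Icc.exists_bound_of_continuousOn (s := Set.Icc (0 : ℝ) 1)
      hf.continuousOn
    exact Integrable.of_bound (hf.measurable.comp hXm).aestronglyMeasurable C
      (Eventually.of_forall fun a => hC _ (hX a))
  have iY {f : ℝ → ℝ} (hf : Continuous f) : Integrable (fun b => w b * f (Y b)) ν := by
    obtain ⟨C, hC⟩ := isCompact_Icc.exists_bound_of_continuousOn (s := Set.Icc (0 : ℝ) 1)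
      hf.continuousOn
    exact hw.mul_bdd (c := C) (hf.measurable.comp hYm).aestronglyMeasurable
      (Eventually.of_forall fun b => hC _ (hY b))
  have hpoly (p : Polynomial ℝ) : ∫ a, p.eval (X a) ∂μ = ∫ b, w b * p.eval (Y b) ∂ν := by
    induction p using Polynomial.induction_on' with
    | add p q hp hq =>
      simp only [Polynomial.eval_add, mul_add]
      rw [integral_add (iX p.continuous) (iX q.continuous),
        integral_add (iY p.continuous) (iY q.continuous), hp, hq]
    | monomial n a =>
      simp only [Polynomial.eval_monomial, mul_left_comm _ a]
      rw [integral_const_mul, integral_const_mul, h]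
  -- Replacing `g` by a polynomial within `ε` on `[0, 1]` costs `ε` on the probability side and `ε *
  -- ∫ |w|` on the weighted side.
  have hε (ε : ℝ) (hε : 0 < ε) :
      |∫ a, g (X a) ∂μ - ∫ b, w b * g (Y b) ∂ν| ≤ ε * (1 + ∫ b, |w b| ∂ν) := by
    obtain ⟨p, hp⟩ := exists_polynomial_near_of_continuousOn 0 1 g hg.continuousOn ε hε
    have e : ∫ a, g (X a) ∂μ - ∫ b, w b * g (Y b) ∂ν =
        ∫ b, (w b * p.eval (Y b) - w b * g (Y b)) ∂ν - ∫ a, (p.eval (X a) - g (X a)) ∂μ := by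
      rw [integral_sub (iY p.continuous) (iY hg), integral_sub (iX p.continuous) (iX hg), hpoly]
      ring
    have e1 : |∫ a, (p.eval (X a) - g (X a)) ∂μ| ≤ ε := by
      have := norm_integral_le_of_norm_le_const (μ := μ) (C := ε)
        (f := fun a => p.eval (X a) - g (X a)) (Eventually.of_forall fun a => (hp _ (hX a)).le)
      simpa using this
    have e2 : |∫ b, (w b * p.eval (Y b) - w b * g (Y b)) ∂ν| ≤ ε * ∫ b, |w b| ∂ν := by
      rw [← integral_const_mul]
      rw [← Real.norm_eq_abs]
      refine norm_integral_le_of_norm_le (hw.abs.const_mul ε) (Eventually.of_forall fun b => ?_)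
      rw [← mul_sub, norm_mul, mul_comm, Real.norm_eq_abs, Real.norm_eq_abs]
      gcongr
      exact (hp _ (hY b)).le
    rw [e]
    calc _ ≤ _ := abs_sub _ _
      _ ≤ ε * (1 + ∫ b, |w b| ∂ν) := by linarith
  have hw0 : 0 ≤ ∫ b, |w b| ∂ν := integral_nonneg fun b => abs_nonneg _
  rw [← sub_eq_zero, ← abs_nonpos_iff]
  refine le_of_forall_pos_le_add fun δ hδ => ?_
  refine (hε (δ / (1 + ∫ b, |w b| ∂ν)) (by positivity)).trans_eq ?_
  field_simp
  ring

variable [MeasurableSpace (Matrix.unitaryGroup (Fin 2) ℂ)]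
  [BorelSpace (Matrix.unitaryGroup (Fin 2) ℂ)]
  (m : Measure (Matrix.unitaryGroup (Fin 2) ℂ))

lemma integral_comp_normTraceSq [m.IsMulLeftInvariant] [IsProbabilityMeasure m] {g : ℝ → ℝ}
    (hg : Continuous g) : ∫ U, g (normTraceSq U) ∂m =
      4 / π * ∫ x in (0 : ℝ)..π / 2, sin x ^ 2 * g (cos x ^ 2) := by
  have hπ : (0 : ℝ) ≤ π / 2 := by positivity
  have hw : Continuous fun x => 4 / π * sin x ^ 2 := by fun_prop
  rw [integral_comp_eq_of_moments (ν := volume.restrict (Set.Ioc 0 (π / 2)))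
    (Y := fun x => cos x ^ 2) (w := fun x => 4 / π * sin x ^ 2)
    (fun U => ⟨normTraceSq_nonneg U, normTraceSq_le_one U⟩)
    (fun x => ⟨sq_nonneg _, cos_sq_le_one x⟩) continuous_normTraceSq.measurable
    (by fun_prop) (hw.integrableOn_Icc.mono_set Set.Ioc_subset_Icc_self) (fun k => ?_) hg]
  · rw [intervalIntegral.integral_of_le hπ, ← integral_const_mul]
    simp only [mul_assoc]
  · rw [integral_normTraceSq_pow, intervalIntegral.integral_of_le hπ, ← integral_const_mul]
    simp only [mul_assoc]

lemma integral_pvmDynamicalEntropy [m.IsMulLeftInvariant] [IsProbabilityMeasure m] :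
    ∫ U, pvmDynamicalEntropy U ∂m =
      3 / 2 * log 2 - 1 / 2 - 1 / (2 * π) + catalanConstant / π := by
  simp only [pvmDynamicalEntropy_eq]
  -- Truncating at `2⁻¹` inside `g` keeps it continuous on the whole line, as the moment argument
  -- requires.
  rw [integral_comp_normTraceSq m (g := fun x => binEntropy (max x 2⁻¹)) (by fun_prop),
    integral_sin_sq_mul_binEntropy_max, ← mul_assoc]
  rw [show 4 / π * (π / 4) = 1 by field_simp, one_mul]

lemma integrable_pvmDynamicalEntropy [IsFiniteMeasure m] :
    Integrable (fun U => pvmDynamicalEntropy U) m := by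
  simp only [pvmDynamicalEntropy_eq]
  have hc := continuous_normTraceSq
  refine integrable_of_continuous_of_bound m (C := log 2) (by fun_prop) fun U => ?_
  rw [abs_of_nonneg (binEntropy_nonneg (le_max_of_le_right (by norm_num))
    (max_le (normTraceSq_le_one U) (by norm_num)))]
  exact binEntropy_le_log_two

end

end QuantumEntropy

theorem mainTheorem8
    [MeasurableSpace (Matrix.unitaryGroup (Fin 2) ℂ)]
    [BorelSpace (Matrix.unitaryGroup (Fin 2) ℂ)]
    -- `m` is the normalized Haar measure on `U(2)`
    (m : MeasureTheory.Measure (Matrix.unitaryGroup (Fin 2) ℂ))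
    [m.IsHaarMeasure] [MeasureTheory.IsProbabilityMeasure m] :
    -- the quantities are well defined: both limits exist and agree, the maximum is attained
    (∀ (U : Matrix.unitaryGroup (Fin 2) ℂ) (φ : QuantumEntropy.PVM 2),
      Filter.Tendsto (fun n : ℕ => QuantumEntropy.blockEntropy U φ n / (n : ℝ))
        Filter.atTop (nhds (QuantumEntropy.entropy U φ)) ∧
      Filter.Tendsto
        (fun n : ℕ => QuantumEntropy.blockEntropy U φ (n + 1) - QuantumEntropy.blockEntropy U φ n)
        Filter.atTop (nhds (QuantumEntropy.entropy U φ))) ∧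
    (∀ U : Matrix.unitaryGroup (Fin 2) ℂ,
      IsGreatest (Set.range fun φ : QuantumEntropy.PVM 2 => QuantumEntropy.dynamicalEntropy U φ)
        (QuantumEntropy.pvmDynamicalEntropy U)) ∧
    MeasureTheory.Integrable
      (fun U : Matrix.unitaryGroup (Fin 2) ℂ => QuantumEntropy.pvmDynamicalEntropy U) m ∧
    -- the average value
    (∫ U, QuantumEntropy.pvmDynamicalEntropy U ∂m) =
      3 / 2 * Real.log 2 - 1 / 2 - 1 / (2 * Real.pi)
        + QuantumEntropy.catalanConstant / Real.pi ∧
    -- the two numerical values, to three decimal places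
    |QuantumEntropy.catalanConstant - 0.916| < 0.0005 ∧
    |(∫ U, QuantumEntropy.pvmDynamicalEntropy U ∂m) - 0.672| < 0.0005 := by
  refine ⟨fun U φ => ?_, fun U => ?_, QuantumEntropy.integrable_pvmDynamicalEntropy m,
    QuantumEntropy.integral_pvmDynamicalEntropy m, QuantumEntropy.abs_catalanConstant_sub_lt, ?_⟩
  · rw [QuantumEntropy.entropy_eq]
    exact ⟨QuantumEntropy.tendsto_blockEntropy_div U φ, QuantumEntropy.tendsto_blockEntropy_sub U φ⟩
  · rw [QuantumEntropy.pvmDynamicalEntropy_eq]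
    exact QuantumEntropy.isGreatest_dynamicalEntropy U
  · rw [QuantumEntropy.integral_pvmDynamicalEntropy m]
    exact QuantumEntropy.abs_average_sub_lt
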